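/- Let $N$ be a natural number and let $R\subset\mathbb{R}^N$ be a finite reduced root system: a finite set of nonzero vectors such that $u\sigma_v\in R$ for all $u,v\in R$, where $x\sigma_v:=x-2\frac{\langle x,v\rangle}{|v|^2}v$, and such that $u,cu\in R$ with $c\in\mathbb{R}$ implies $c=\pm1$. Let $W(R)$ be the finite reflection group generated by $\{\sigma_v:v\in R\}$, let $u_0\in\mathbb{R}^N$ satisfy $\langle u_0,v\rangle\neq0$ for all $v\in R$, and put $R_+=\{v\in R:\langle u_0,v\rangle>0\}$. Let $\kappa_v\ge0$ ($v\in R$) be real numbers with $\kappa_u=\kappa_v$ whenever $u,v\in R$ lie in the same $W(R)$-orbit, and let $\omega>0$ be real. On $\mathcal{P}=\mathbb{R}[x_1,\dots,x_N]$ define the Dunkl operators $$\mathcal{D}_ip(x)=\frac{\partial p}{\partial x_i}(x)+\sum_{v\in R_+}\kappa_v\frac{p(x)-p(x\sigma_v)}{\langle x,v\rangle}v_i\qquad(1\le i\le N),$$ the Dunkl Laplacian $\Delta_\kappa=\sum_{i=1}^N\mathcal{D}_i^2$, and the operator $$\boldsymbol{E}=\exp\Big(\frac{\Delta_\kappa}{4\omega}\Big)=\sum_{n\ge0}\frac{\Delta_\kappa^n}{(4\omega)^n\,n!},$$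 which is a finite sum on each polynomial. Let $h_\kappa(x)=\prod_{v\in R_+}|\langle x,v\rangle|^{\kappa_v}$, and for $p,q\in\mathcal{P}$ let $$\langle p,q\rangle_2=c_{\kappa,\omega}\int_{\mathbb{R}^N}p(x)q(x)e^{-\omega|x|^2}h_\kappa(x)^2\,dx,\qquad c_{\kappa,\omega}^{-1}=\int_{\mathbb{R}^N}e^{-\omega|x|^2}h_\kappa(x)^2\,dx,$$ $$\langle p,q\rangle_{\kappa,\omega}=p\Big(\tfrac1{2\omega}\mathcal{D}_1,\dots,\tfrac1{2\omega}\mathcal{D}_N\Big)q(x)\Big|_{x=0}.$$ Then, for all $p,q\in\mathcal{P}$, the integral defining $c_{\kappa,\omega}^{-1}$ is positive and finite, the integral defining $\langle p,q\rangle_2$ converges absolutely, and $$\langle\boldsymbol{E}p,\boldsymbol{E}q\rangle_{\kappa,\omega}=\langle p,q\rangle_2.$$ -/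

import Mathlib

open MeasureTheory MvPolynomial

noncomputable section

namespace Dunkl

variable {N : ℕ}

/-- The Euclidean space `ℝ^N`. -/
abbrev Space (N : ℕ) : Type := EuclideanSpace ℝ (Fin N)

/-- The polynomial ring `ℝ[x_1, …, x_N]`. -/
abbrev Poly (N : ℕ) : Type := MvPolynomial (Fin N) ℝ

/-- The reflection `x ↦ x - 2 ⟨x, v⟩ / |v|² • v` along `v`. -/
def refl (v : Space N) : Space N ≃ₗᵢ[ℝ] Space N :=
  (Submodule.span ℝ {v})ᗮ.reflection

theorem refl_apply (v x : Space N) :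
    refl v x = x - (2 * inner ℝ x v / ‖v‖ ^ 2) • v := by
  unfold refl
  rw [Submodule.reflection_orthogonal_apply, Submodule.reflection_singleton_apply]
  rw [neg_sub, ← Nat.cast_smul_eq_nsmul ℝ, smul_smul, real_inner_comm]
  congr 2
  simp
  ring

/-- Finite reduced root systems: finite sets of nonzero vectors, stable under the reflections
along their members, with no proportional members other than `v` and `-v`. -/
structure IsReducedRootSystem (R : Finset (Space N)) : Prop where
  ne_zero : ∀ v ∈ R, v ≠ 0
  refl_mem : ∀ u ∈ R, ∀ v ∈ R, refl v u ∈ R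
  reduced : ∀ u ∈ R, ∀ c : ℝ, c • u ∈ R → c = 1 ∨ c = -1

/-- The reflection group generated by the reflections along the members of `R`. -/
def reflectionGroup (R : Finset (Space N)) : Subgroup (Space N ≃ₗᵢ[ℝ] Space N) :=
  Subgroup.closure (refl '' (R : Set (Space N)))

/-- `κ` is constant on each orbit of the reflection group in `R`
(its values outside `R` are irrelevant). -/
def IsMultiplicity (R : Finset (Space N)) (κ : Space N → ℝ) : Prop :=
  ∀ v ∈ R, ∀ w ∈ reflectionGroup R, κ (w v) = κ v

/-- The positive roots determined by a vector `u₀`. -/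
def posRoots (R : Finset (Space N)) (u₀ : Space N) : Finset (Space N) :=
  open Classical in R.filter fun v => 0 < inner ℝ u₀ v

/-- The linear form `⟨x, v⟩` as a polynomial in `x`. -/
def linForm (v : Space N) : Poly N := ∑ j, C (v j) * X j

theorem eval_linForm (v x : Space N) : eval (fun i => x i) (linForm v) = inner ℝ x v := by
  simp [linForm, PiLp.inner_apply]

theorem linForm_ne_zero {v : Space N} (hv : v ≠ 0) : linForm v ≠ 0 := by
  intro h
  have := eval_linForm v v
  rw [h, map_zero] at this
  exact hv (inner_self_eq_zero.mp this.symm)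

/-- The polynomial `p(x σ_v)`, see `eval_reflPoly`. -/
def reflPoly (v : Space N) : Poly N →ₐ[ℝ] Poly N :=
  aeval fun i => X i - C (2 * v i / ‖v‖ ^ 2) * linForm v

theorem eval_reflPoly (v x : Space N) (p : Poly N) :
    eval (fun i => x i) (reflPoly v p) = eval (fun i => refl v x i) p := by
  induction p using MvPolynomial.induction_on with
  | C a => simp [reflPoly]
  | add p q hp hq => simp [hp, hq]
  | mul_X p i hp =>
    rw [map_mul, map_mul, map_mul, hp, refl_apply]
    simp [reflPoly, eval_linForm]
    left
    ring

theorem linForm_dvd (v : Space N) (p : Poly N) : linForm v ∣ p - reflPoly v p := by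
  induction p using MvPolynomial.induction_on with
  | C a => simp [reflPoly]
  | add p q hp hq =>
    have : p + q - reflPoly v (p + q) = (p - reflPoly v p) + (q - reflPoly v q) := by
      rw [map_add]; ring
    rw [this]
    exact dvd_add hp hq
  | mul_X p i hp =>
    have : p * X i - reflPoly v (p * X i) =
        (p - reflPoly v p) * X i + linForm v * (C (2 * v i / ‖v‖ ^ 2) * reflPoly v p) := by
      have hX : reflPoly v (X i) = X i - C (2 * v i / ‖v‖ ^ 2) * linForm v := by simp [reflPoly]
      rw [map_mul, hX]; ring
    rw [this]
    exact dvd_add (hp.mul_right _) (dvd_mul_right _ _)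

/-- The polynomial `(p(x) - p(x σ_v)) / ⟨x, v⟩` for `v ≠ 0`, see `linForm_mul_divDiff`. -/
def divDiffFun (v : Space N) (p : Poly N) : Poly N :=
  open Classical in if v = 0 then 0 else (linForm_dvd v p).choose

theorem linForm_mul_divDiffFun {v : Space N} (hv : v ≠ 0) (p : Poly N) :
    linForm v * divDiffFun v p = p - reflPoly v p := by
  rw [divDiffFun, if_neg hv]
  exact (linForm_dvd v p).choose_spec.symm

/-- The linear operator `p ↦ (p(x) - p(x σ_v)) / ⟨x, v⟩` on polynomials. -/
def divDiff (v : Space N) : Module.End ℝ (Poly N) where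
  toFun := divDiffFun v
  map_add' p q := by
    by_cases hv : v = 0
    · simp [divDiffFun, hv]
    · apply mul_left_cancel₀ (linForm_ne_zero hv)
      rw [mul_add, linForm_mul_divDiffFun hv, linForm_mul_divDiffFun hv,
        linForm_mul_divDiffFun hv, map_add]
      ring
  map_smul' c p := by
    by_cases hv : v = 0
    · simp [divDiffFun, hv]
    · apply mul_left_cancel₀ (linForm_ne_zero hv)
      rw [RingHom.id_apply, mul_smul_comm, linForm_mul_divDiffFun hv,
        linForm_mul_divDiffFun hv, map_smul, smul_sub]

theorem linForm_mul_divDiff {v : Space N} (hv : v ≠ 0) (p : Poly N) :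
    linForm v * divDiff v p = p - reflPoly v p :=
  linForm_mul_divDiffFun hv p

/-- The Dunkl operator
`D_i p(x) = ∂p/∂x_i (x) + ∑_{v ∈ R₊} κ_v (p(x) - p(x σ_v)) / ⟨x, v⟩ · v_i`, where `Rp` is the
set `R₊` of positive roots. -/
def dunklOp (Rp : Finset (Space N)) (κ : Space N → ℝ) (i : Fin N) : Module.End ℝ (Poly N) :=
  (pderiv i).toLinearMap + ∑ v ∈ Rp, (κ v * v i) • divDiff v

/-- The Dunkl Laplacian `∑_i D_i²`. -/
def dunklLaplacian (Rp : Finset (Space N)) (κ : Space N → ℝ) : Module.End ℝ (Poly N) :=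
  ∑ i, dunklOp Rp κ i ^ 2

/-- `exp(Δ_κ / (4ω)) p = ∑_n (Δ_κ^n p) / ((4ω)^n n!)`. The sum is finite for every `p`,
see `finite_support_expTerm`. -/
def expLaplacian (Rp : Finset (Space N)) (κ : Space N → ℝ) (ω : ℝ) (p : Poly N) : Poly N :=
  ∑ᶠ n : ℕ, ((4 * ω) ^ n * (n.factorial : ℝ))⁻¹ • (dunklLaplacian Rp κ ^ n) p

/-- The operator `p(T_1, …, T_N)`, with the factors of each monomial in the order of the indices
(the order is immaterial when the `T_i` commute, as Dunkl operators do). -/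
def polyOp (T : Fin N → Module.End ℝ (Poly N)) (p : Poly N) : Module.End ℝ (Poly N) :=
  ∑ α ∈ p.support, coeff α p • (List.ofFn fun i => T i ^ α i).prod

/-- The algebraic pairing `⟨p, q⟩_{κ,ω} = p(D_1/(2ω), …, D_N/(2ω)) q |_{x = 0}`. -/
def algPairing (Rp : Finset (Space N)) (κ : Space N → ℝ) (ω : ℝ) (p q : Poly N) : ℝ :=
  eval 0 (polyOp (fun i => (1 / (2 * ω)) • dunklOp Rp κ i) p q)

/-- The weight function `h_κ(x) = ∏_{v ∈ R₊} |⟨x, v⟩|^{κ_v}`. -/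
def weight (Rp : Finset (Space N)) (κ : Space N → ℝ) (x : Space N) : ℝ :=
  ∏ v ∈ Rp, |inner ℝ x v| ^ κ v

/-- The integral `∫ exp(-ω|x|²) h_κ(x)² dx`, whose inverse is the normalization constant. -/
def gaussMass (Rp : Finset (Space N)) (κ : Space N → ℝ) (ω : ℝ) : ℝ :=
  ∫ x : Space N, Real.exp (-ω * ‖x‖ ^ 2) * weight Rp κ x ^ 2

/-- The integrand `p(x) q(x) exp(-ω|x|²) h_κ(x)²`. -/
def gaussIntegrand (Rp : Finset (Space N)) (κ : Space N → ℝ) (ω : ℝ) (p q : Poly N)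
    (x : Space N) : ℝ :=
  eval (fun i => x i) p * eval (fun i => x i) q * Real.exp (-ω * ‖x‖ ^ 2) * weight Rp κ x ^ 2

/-- The normalized Gaussian inner product `⟨p, q⟩₂`. -/
def gaussPairing (Rp : Finset (Space N)) (κ : Space N → ℝ) (ω : ℝ) (p q : Poly N) : ℝ :=
  (gaussMass Rp κ ω)⁻¹ * ∫ x : Space N, gaussIntegrand Rp κ ω p q x

/-! Dunkl operators lower the degree, so the exponential series is a finite sum. -/

theorem totalDegree_linForm_le (v : Space N) : (linForm v).totalDegree ≤ 1 := by
  refine (totalDegree_finsetSum _ _).trans (Finset.sup_le fun j _ => ?_)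
  refine (totalDegree_mul _ _).trans ?_
  simp

theorem one_le_totalDegree_linForm {v : Space N} (hv : v ≠ 0) :
    1 ≤ (linForm v).totalDegree := by
  by_contra h
  have h0 : (linForm v).totalDegree = 0 := by omega
  rw [totalDegree_eq_zero_iff_eq_C] at h0
  have h1 : eval (fun i => v i) (linForm v) = eval (fun i => (0 : Space N) i) (linForm v) := by
    rw [h0]; simp
  rw [eval_linForm, eval_linForm, inner_zero_left] at h1
  exact hv (inner_self_eq_zero.mp h1)

theorem totalDegree_reflPoly_le (v : Space N) (p : Poly N) :
    (reflPoly v p).totalDegree ≤ p.totalDegree := by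
  unfold reflPoly
  rw [aeval_def, eval₂_eq']
  refine (totalDegree_finsetSum _ _).trans (Finset.sup_le fun α hα => ?_)
  refine (totalDegree_mul _ _).trans ?_
  have hc : (algebraMap ℝ (Poly N) (coeff α p)).totalDegree = 0 := totalDegree_C _
  rw [hc, zero_add]
  refine (totalDegree_finsetProd _ _).trans ?_
  refine le_trans ?_ (le_totalDegree hα)
  rw [Finsupp.sum_fintype _ _ (fun _ => rfl)]
  refine Finset.sum_le_sum fun i _ => ?_
  refine (totalDegree_pow _ _).trans ?_
  refine (Nat.mul_le_mul_left _ ?_).trans (Nat.mul_one _).le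
  refine (totalDegree_sub _ _).trans (max_le (totalDegree_X _).le ?_)
  refine (totalDegree_mul _ _).trans ?_
  rw [totalDegree_C, zero_add]
  exact totalDegree_linForm_le v

theorem divDiff_C (v : Space N) (a : ℝ) : divDiff v (C a) = 0 := by
  by_cases hv : v = 0
  · simp [divDiff, divDiffFun, hv]
  · apply mul_left_cancel₀ (linForm_ne_zero hv)
    rw [linForm_mul_divDiff hv]
    simp [reflPoly]

theorem totalDegree_divDiff_le (v : Space N) (p : Poly N) :
    (divDiff v p).totalDegree ≤ p.totalDegree - 1 := by
  by_cases h0 : divDiff v p = 0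
  · simp [h0]
  by_cases hv : v = 0
  · simp [divDiff, divDiffFun, hv]
  have h := congrArg totalDegree (linForm_mul_divDiff hv p)
  rw [totalDegree_mul_of_isDomain (linForm_ne_zero hv) h0] at h
  have h1 := totalDegree_sub p (reflPoly v p)
  have h2 := totalDegree_reflPoly_le v p
  have h3 := one_le_totalDegree_linForm hv
  omega

theorem dunklOp_C (Rp : Finset (Space N)) (κ : Space N → ℝ) (i : Fin N) (a : ℝ) :
    dunklOp Rp κ i (C a) = 0 := by
  simp [dunklOp, divDiff_C]

theorem totalDegree_dunklOp_le (Rp : Finset (Space N)) (κ : Space N → ℝ) (i : Fin N)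
    (p : Poly N) : (dunklOp Rp κ i p).totalDegree ≤ p.totalDegree - 1 := by
  have hp : (pderiv i p).totalDegree ≤ p.totalDegree - 1 := by
    refine Finset.sup_le fun α hα => ?_
    rw [mem_support_iff, coeff_pderiv] at hα
    have h1 := le_totalDegree (mem_support_iff.mpr (left_ne_zero_of_mul hα))
    rw [Finsupp.sum_fintype _ _ (fun _ => rfl)] at h1 ⊢
    simp only [Finsupp.add_apply, Finset.sum_add_distrib] at h1
    have h2 : ∑ j, (Finsupp.single i 1 : Fin N →₀ ℕ) j = 1 := by
      simp [Finsupp.single_apply]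
    omega
  simp only [dunklOp, LinearMap.add_apply, LinearMap.sum_apply, LinearMap.smul_apply]
  refine (totalDegree_add _ _).trans (max_le hp ?_)
  refine (totalDegree_finsetSum _ _).trans (Finset.sup_le fun v _ => ?_)
  exact (totalDegree_smul_le _ _).trans (totalDegree_divDiff_le v p)

theorem totalDegree_dunklLaplacian_le (Rp : Finset (Space N)) (κ : Space N → ℝ) (p : Poly N) :
    (dunklLaplacian Rp κ p).totalDegree ≤ p.totalDegree - 1 := by
  simp only [dunklLaplacian, LinearMap.sum_apply, pow_two, Module.End.mul_apply]
  refine (totalDegree_finsetSum _ _).trans (Finset.sup_le fun i _ => ?_)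
  refine (totalDegree_dunklOp_le Rp κ i _).trans ?_
  exact (Nat.sub_le _ _).trans (totalDegree_dunklOp_le Rp κ i p)

theorem dunklLaplacian_pow_eq_zero (Rp : Finset (Space N)) (κ : Space N → ℝ) (p : Poly N)
    {n : ℕ} (hn : p.totalDegree < n) : (dunklLaplacian Rp κ ^ n) p = 0 := by
  induction n generalizing p with
  | zero => omega
  | succ n ih =>
    rw [pow_succ, Module.End.mul_apply]
    by_cases h : p.totalDegree = 0
    · rw [totalDegree_eq_zero_iff_eq_C] at h
      have : dunklLaplacian Rp κ p = 0 := by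
        rw [h]
        simp [dunklLaplacian, pow_two, dunklOp_C]
      rw [this, map_zero]
    · apply ih
      have := totalDegree_dunklLaplacian_le Rp κ p
      omega

theorem finite_support_expTerm (Rp : Finset (Space N)) (κ : Space N → ℝ) (ω : ℝ) (p : Poly N) :
    (Function.support fun n : ℕ =>
      ((4 * ω) ^ n * (n.factorial : ℝ))⁻¹ • (dunklLaplacian Rp κ ^ n) p).Finite := by
  refine (Set.finite_Iic p.totalDegree).subset fun n hn => ?_
  by_contra h
  apply hn
  simp only [Set.mem_Iic, not_le] at h
  simp [dunklLaplacian_pow_eq_zero Rp κ p h]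

end Dunkl

end

noncomputable section

namespace Dunkl

variable {N : ℕ}

/-! ### Reflections of polynomials and commutation of Dunkl operators with coordinates -/

/-! Let `L p` be the integral of `p` against exp(-ω|x|²) h_κ², write D_i for the Dunkl operators,
σ_v for `reflPoly v`, Δ for `dunklLaplacian`, and F = exp(-Δ/(4ω)), which is `expLaplacian` at `-ω`.
Everything algebraic follows from the properties of `L` collected in `IsDunklGaussian`; the key one
is integration by parts: the adjoint of D_i under `L (p * q)` is 2ω x_i - D_i.

A degree-lowering operator that is antisymmetric for a definite form vanishes
(`eq_zero_of_antisymm`). Applied to [D_i, D_j] and to σ_v D_v + D_v σ_v, with D_v = ∑_j v_j D_j,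
this gives commutativity and reflection equivariance in the direction of the root without any
computation in the root system. Hence [Δ, x_i] = 2 D_i and F x_i = (x_i - D_i/(2ω)) F. With
integration by parts, multiplication by x_i is then adjoint to D_i/(2ω) for the form L(Fp · Fq), so
L(Fp · Fq) = L(F r) with r = p(D/(2ω)) q. Moreover L(F r) = L(1) r(0), because D_i kills constants.
Thus L(Fp · Fq) is L(1) times the algebraic pairing, and replacing p, q by their images under
exp(Δ/(4ω)), the inverse of F, gives the theorem (`algPairing_expLaplacian`).

The analytic input is integration by parts (`isDunklGaussian_gaussFunctional`). As h_κ² may fail to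
be differentiable on the mirrors, it is replaced by ∏ (⟨x,v⟩² + ε)^{κ_v}. Its logarithmic derivative
contains kernels ⟨x,v⟩/(⟨x,v⟩² + ε), odd under σ_v; oddness turns 2pq into ⟨x,v⟩ times difference
quotients, after which ε → 0 is dominated convergence. -/

theorem poly_ext {p q : Poly N}
    (h : ∀ x : Space N, eval (fun i => x i) p = eval (fun i => x i) q) : p = q :=
  MvPolynomial.funext fun x => h (WithLp.toLp 2 x)

theorem reflPoly_reflPoly (v : Space N) (p : Poly N) : reflPoly v (reflPoly v p) = p := by
  refine poly_ext fun x => ?_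
  rw [eval_reflPoly, eval_reflPoly v (refl v x)]
  simp [refl]

theorem reflPoly_linForm {v : Space N} (hv : v ≠ 0) : reflPoly v (linForm v) = -linForm v := by
  refine poly_ext fun x => ?_
  have h : ‖v‖ ^ 2 ≠ 0 := by simpa using hv
  rw [eval_reflPoly, map_neg, eval_linForm, eval_linForm, refl_apply, inner_sub_left,
    real_inner_smul_left, real_inner_self_eq_norm_sq, div_mul_cancel₀ _ h]
  ring

theorem divDiff_X_mul {v : Space N} (hv : v ≠ 0) (j : Fin N) (p : Poly N) :
    divDiff v (X j * p) = X j * divDiff v p + (2 * v j / ‖v‖ ^ 2) • reflPoly v p := by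
  apply mul_left_cancel₀ (linForm_ne_zero hv)
  have hX : reflPoly v (X j) = X j - C (2 * v j / ‖v‖ ^ 2) * linForm v := by simp [reflPoly]
  rw [linForm_mul_divDiff hv, map_mul, hX, mul_add, mul_left_comm, linForm_mul_divDiff hv,
    smul_eq_C_mul]
  ring

/-- The commutator [D_i, x_j] read off here is symmetric in `i` and `j`, which is what commutativity
of the D_i rests on. -/
theorem dunklOp_X_mul {Rp : Finset (Space N)} (hRp : ∀ v ∈ Rp, v ≠ 0) (κ : Space N → ℝ)
    (i j : Fin N) (p : Poly N) :
    dunklOp Rp κ i (X j * p) = X j * dunklOp Rp κ i p + (if i = j then p else 0) +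
      ∑ v ∈ Rp, (κ v * v i * (2 * v j / ‖v‖ ^ 2)) • reflPoly v p := by
  simp only [dunklOp, LinearMap.add_apply, LinearMap.sum_apply, LinearMap.smul_apply]
  have h : ∑ v ∈ Rp, (κ v * v i) • divDiff v (X j * p) =
      X j * ∑ v ∈ Rp, (κ v * v i) • divDiff v p +
        ∑ v ∈ Rp, (κ v * v i * (2 * v j / ‖v‖ ^ 2)) • reflPoly v p := by
    rw [Finset.mul_sum, ← Finset.sum_add_distrib]
    refine Finset.sum_congr rfl fun v hv => ?_
    rw [divDiff_X_mul (hRp v hv), smul_add, smul_smul, mul_smul_comm]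
  rw [h]
  have hp : pderiv i (X j * p) = X j * pderiv i p + (if i = j then p else 0) := by
    rw [Derivation.leibniz, pderiv_X]
    by_cases hij : i = j
    · subst hij; simp
    · simp [hij, Ne.symm hij]
  simp only [Derivation.coeFn_coe, hp]
  ring

/-! ### Degree-lowering operators that are antisymmetric for a definite form vanish -/

theorem exists_pow_apply_eq_zero (T : Module.End ℝ (Poly N)) (hC : ∀ a, T (C a) = 0)
    (hdeg : ∀ p, (T p).totalDegree ≤ p.totalDegree - 1) (p : Poly N) : ∃ n, (T ^ n) p = 0 := by
  have key : ∀ d (p : Poly N), p.totalDegree ≤ d → (T ^ (d + 1)) p = 0 := by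
    intro d
    induction d with
    | zero =>
      intro p hp
      rw [Nat.le_zero, totalDegree_eq_zero_iff_eq_C] at hp
      rw [hp, zero_add, pow_one, hC]
    | succ d ih =>
      intro p hp
      rw [pow_succ, Module.End.mul_apply]
      exact ih _ ((hdeg p).trans (by omega))
  exact ⟨_, key _ p le_rfl⟩

/-- As for antisymmetric matrices, T²p = 0 forces L(Tp · Tp) = -L(p · T²p) = 0 and so Tp = 0; local
nilpotency then descends to T = 0. -/
theorem eq_zero_of_antisymm (L : Poly N →ₗ[ℝ] ℝ) (hpos : ∀ p, L (p * p) = 0 → p = 0)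
    (T : Module.End ℝ (Poly N)) (hT : ∀ p q, L (T p * q) = -L (p * T q))
    (hn : ∀ p, ∃ n, (T ^ n) p = 0) : T = 0 := by
  have key : ∀ n p, (T ^ n) p = 0 → T p = 0 := by
    intro n
    induction n with
    | zero => intro p hp; rw [show p = 0 from hp, map_zero]
    | succ n ih =>
      intro p hp
      rw [pow_succ, Module.End.mul_apply] at hp
      refine hpos _ ?_
      rw [hT, ih _ hp, mul_zero, map_zero, neg_zero]
  refine LinearMap.ext fun p => ?_
  obtain ⟨n, h⟩ := hn p
  exact key n p h

/-- The properties of the Gaussian functional `L` that are used by the algebraic part of the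
argument: definiteness, reflection invariance and integration by parts. -/
structure IsDunklGaussian (Rp : Finset (Space N)) (κ : Space N → ℝ) (ω : ℝ)
    (L : Poly N →ₗ[ℝ] ℝ) : Prop where
  ne_zero : ∀ v ∈ Rp, v ≠ 0
  definite : ∀ p, L (p * p) = 0 → p = 0
  reflPoly : ∀ v ∈ Rp, ∀ p, L (reflPoly v p) = L p
  parts : ∀ i p q, L (dunklOp Rp κ i p * q) + L (p * dunklOp Rp κ i q) =
    2 * ω * L (X i * (p * q))

/-! ### Commutation relations forced by the Gaussian functional -/

namespace IsDunklGaussian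

variable {Rp : Finset (Space N)} {κ : Space N → ℝ} {ω : ℝ} {L : Poly N →ₗ[ℝ] ℝ}

/-- The adjoint of [D_i, D_j] is [2ω x_j - D_j, 2ω x_i - D_i]; the mixed terms cancel since [D_i,
x_j] = [D_j, x_i], leaving -[D_i, D_j]. -/
theorem commute_dunklOp (hL : IsDunklGaussian Rp κ ω L) (i j : Fin N) :
    Commute (dunklOp Rp κ i) (dunklOp Rp κ j) := by
  set D := dunklOp Rp κ
  suffices h : D i * D j - D j * D i = 0 from sub_eq_zero.mp h
  refine eq_zero_of_antisymm L hL.definite _ (fun p q => ?_)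
    (exists_pow_apply_eq_zero _ (fun a => by simp [D, dunklOp_C]) fun p => ?_)
  · have hc : D i (X j * q) - X j * D i q = D j (X i * q) - X i * D j q := by
      simp only [D, dunklOp_X_mul hL.ne_zero]
      have : ∑ v ∈ Rp, (κ v * v i * (2 * v j / ‖v‖ ^ 2)) • Dunkl.reflPoly v q =
          ∑ v ∈ Rp, (κ v * v j * (2 * v i / ‖v‖ ^ 2)) • Dunkl.reflPoly v q :=
        Finset.sum_congr rfl fun v _ => by congr 1; ring
      rw [this]
      simp only [eq_comm (a := j)]
      ring
    have hc' := congrArg (fun r => L (p * r)) hc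
    simp only [mul_sub, map_sub] at hc'
    have h1 := hL.parts i (D j p) q
    have h2 := hL.parts j p (D i q)
    have h3 := hL.parts j (D i p) q
    have h4 := hL.parts i p (D j q)
    have h5 := hL.parts j p (X i * q)
    have h6 := hL.parts i p (X j * q)
    rw [mul_left_comm (X i)] at h1 h4
    rw [mul_left_comm (X j)] at h3 h2
    have e : X j * (p * (X i * q)) = X i * (p * (X j * q)) := by ring
    rw [e] at h5
    simp only [LinearMap.sub_apply, Module.End.mul_apply, sub_mul, mul_sub, map_sub]
    linear_combination h1 - h2 - h3 + h4 + 2 * ω * (h5 - h6) + 2 * ω * hc'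
  · simp only [LinearMap.sub_apply, Module.End.mul_apply]
    refine (totalDegree_sub _ _).trans (max_le ?_ ?_)
    all_goals
      refine (totalDegree_dunklOp_le Rp κ _ _).trans ?_
      exact (Nat.sub_le _ _).trans (totalDegree_dunklOp_le Rp κ _ p)

/-- The reflection is self-adjoint and anticommutes with multiplication by ⟨x,v⟩, so the 2ω terms
drop out of the adjoint of σ_v D_v + D_v σ_v, which is therefore antisymmetric. -/
theorem reflPoly_dunklOp_add (hL : IsDunklGaussian Rp κ ω L) {v : Space N} (hv : v ∈ Rp)
    (p : Poly N) :
    ∑ j, v j • (Dunkl.reflPoly v (dunklOp Rp κ j p) + dunklOp Rp κ j (Dunkl.reflPoly v p)) =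
      0 := by
  set D : Module.End ℝ (Poly N) := ∑ j, v j • dunklOp Rp κ j with hD
  set σ : Module.End ℝ (Poly N) := (Dunkl.reflPoly v).toLinearMap with hσ
  have hσa : ∀ p, σ p = Dunkl.reflPoly v p := fun _ => rfl
  have hDC : ∀ a, D (C a) = 0 := fun a => by simp [D, dunklOp_C, LinearMap.sum_apply]
  have hDdeg : ∀ p, (D p).totalDegree ≤ p.totalDegree - 1 := fun p => by
    simp only [D, LinearMap.sum_apply, LinearMap.smul_apply]
    refine (totalDegree_finsetSum _ _).trans (Finset.sup_le fun j _ => ?_)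
    exact (totalDegree_smul_le _ _).trans (totalDegree_dunklOp_le Rp κ j p)
  have hparts : ∀ p q, L (D p * q) + L (p * D q) = 2 * ω * L (linForm v * (p * q)) := by
    intro p q
    simp only [D, LinearMap.sum_apply, LinearMap.smul_apply, Finset.sum_mul, Finset.mul_sum,
      map_sum, linForm, smul_mul_assoc, mul_smul_comm, map_smul, C_mul']
    rw [← Finset.sum_add_distrib]
    refine Finset.sum_congr rfl fun j _ => ?_
    have := hL.parts j p q
    simp only [smul_eq_mul]
    linear_combination v j * this
  have hadj : ∀ p q, L (σ p * q) = L (p * σ q) := fun p q => by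
    rw [← hL.reflPoly v hv, map_mul, hσa, hσa, reflPoly_reflPoly]
  suffices h : σ * D + D * σ = 0 by
    have := LinearMap.congr_fun h p
    simpa [D, σ, LinearMap.sum_apply, Finset.sum_add_distrib] using this
  refine eq_zero_of_antisymm L hL.definite _ (fun p q => ?_)
    (exists_pow_apply_eq_zero _ (fun a => ?_) fun p => ?_)
  · have h1 := hparts (σ p) q
    have h2 := hparts p (σ q)
    have h3 := hadj (D p) q
    have h4 := hadj p (D q)
    have h5 : L (linForm v * (σ p * q)) = -L (linForm v * (p * σ q)) := by
      rw [← hL.reflPoly v hv, map_mul (Dunkl.reflPoly v), map_mul (Dunkl.reflPoly v),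
        reflPoly_linForm (hL.ne_zero v hv), hσa, hσa, reflPoly_reflPoly, neg_mul, map_neg]
    simp only [LinearMap.add_apply, Module.End.mul_apply, add_mul, mul_add, map_add]
    linear_combination h1 + h2 + h3 - h4 + 2 * ω * h5
  · have : σ (C a) = C a := by simp [hσa, Dunkl.reflPoly]
    simp [hDC, this]
  · simp only [LinearMap.add_apply, Module.End.mul_apply]
    refine (totalDegree_add _ _).trans (max_le ?_ ?_)
    · exact (totalDegree_reflPoly_le v _).trans (hDdeg p)
    · exact (hDdeg _).trans (Nat.sub_le_sub_right (totalDegree_reflPoly_le v p) 1)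

/-- Commuting x_i past D_j twice leaves reflection terms; summed over j they become, for each root,
a multiple of σ_v D_v + D_v σ_v, which is zero. -/
theorem dunklLaplacian_X_mul (hL : IsDunklGaussian Rp κ ω L) (i : Fin N) (p : Poly N) :
    dunklLaplacian Rp κ (X i * p) =
      X i * dunklLaplacian Rp κ p + (2 : ℝ) • dunklOp Rp κ i p := by
  have h : ∀ j, dunklOp Rp κ j (dunklOp Rp κ j (X i * p)) =
      X i * dunklOp Rp κ j (dunklOp Rp κ j p) + (if j = i then (2 : ℝ) • dunklOp Rp κ j p else 0) +
        ∑ v ∈ Rp, (κ v * (2 * v i / ‖v‖ ^ 2)) • v j •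
          (Dunkl.reflPoly v (dunklOp Rp κ j p) + dunklOp Rp κ j (Dunkl.reflPoly v p)) := by
    intro j
    rw [dunklOp_X_mul hL.ne_zero, map_add, map_add, dunklOp_X_mul hL.ne_zero, map_sum]
    have : ∀ v, (κ v * (2 * v i / ‖v‖ ^ 2)) • v j •
          (Dunkl.reflPoly v (dunklOp Rp κ j p) + dunklOp Rp κ j (Dunkl.reflPoly v p)) =
        (κ v * v j * (2 * v i / ‖v‖ ^ 2)) • Dunkl.reflPoly v (dunklOp Rp κ j p) +
        dunklOp Rp κ j ((κ v * v j * (2 * v i / ‖v‖ ^ 2)) • Dunkl.reflPoly v p) := by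
      intro v
      rw [map_smul, ← smul_add, smul_smul]
      congr 1; ring
    rw [Finset.sum_congr rfl fun v _ => this v, Finset.sum_add_distrib]
    by_cases hji : j = i
    · simp only [hji, if_true, two_smul]; abel
    · simp only [hji, if_false, map_zero]; abel
  simp only [dunklLaplacian, LinearMap.sum_apply, pow_two, Module.End.mul_apply]
  rw [Finset.sum_congr rfl fun j _ => h j, Finset.sum_add_distrib, Finset.sum_add_distrib,
    Finset.sum_comm (s := Finset.univ) (t := Rp), ← Finset.mul_sum, Finset.sum_ite_eq' ]
  have h0 : ∑ v ∈ Rp, ∑ j, (κ v * (2 * v i / ‖v‖ ^ 2)) • v j •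
      (Dunkl.reflPoly v (dunklOp Rp κ j p) + dunklOp Rp κ j (Dunkl.reflPoly v p)) = 0 :=
    Finset.sum_eq_zero fun v hv => by
      rw [← Finset.smul_sum, hL.reflPoly_dunklOp_add hv, smul_zero]
  rw [h0]
  simp

theorem commute_dunklLaplacian (hL : IsDunklGaussian Rp κ ω L) (i : Fin N) :
    Commute (dunklLaplacian Rp κ) (dunklOp Rp κ i) :=
  Commute.sum_left _ _ _ fun j _ => (hL.commute_dunklOp j i).pow_left 2

theorem dunklLaplacian_pow_X_mul (hL : IsDunklGaussian Rp κ ω L) (i : Fin N) (n : ℕ)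
    (p : Poly N) :
    (dunklLaplacian Rp κ ^ (n + 1)) (X i * p) = X i * (dunklLaplacian Rp κ ^ (n + 1)) p +
      (2 * (n + 1) : ℝ) • dunklOp Rp κ i ((dunklLaplacian Rp κ ^ n) p) := by
  induction n with
  | zero => simpa using hL.dunklLaplacian_X_mul i p
  | succ n ih =>
    have hc := LinearMap.congr_fun (hL.commute_dunklLaplacian i).eq
      ((dunklLaplacian Rp κ ^ n) p)
    simp only [Module.End.mul_apply] at hc
    rw [pow_succ', Module.End.mul_apply, ih, map_add, hL.dunklLaplacian_X_mul, map_smul, hc,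
      Module.End.mul_apply, add_assoc, ← Module.End.mul_apply _ (_ ^ n), ← pow_succ', ← add_smul]
    congr 2
    push_cast
    ring

end IsDunklGaussian

/-! ### The exponential of the Dunkl Laplacian -/

/-- The free cutoff `M` lets series of different polynomials be compared over one range. -/
theorem expLaplacian_eq_sum (Rp : Finset (Space N)) (κ : Space N → ℝ) (ω : ℝ) (p : Poly N)
    {M : ℕ} (hM : p.totalDegree < M) :
    expLaplacian Rp κ ω p = ∑ n ∈ Finset.range M,
      ((4 * ω) ^ n * (n.factorial : ℝ))⁻¹ • (dunklLaplacian Rp κ ^ n) p := by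
  refine finsum_eq_sum_of_support_subset _ fun n hn => ?_
  by_contra h
  apply hn
  simp only [Finset.coe_range, Set.mem_Iio, not_lt] at h
  simp [dunklLaplacian_pow_eq_zero Rp κ p (hM.trans_le h)]

theorem expLaplacian_add (Rp : Finset (Space N)) (κ : Space N → ℝ) (ω : ℝ) (p q : Poly N) :
    expLaplacian Rp κ ω (p + q) = expLaplacian Rp κ ω p + expLaplacian Rp κ ω q := by
  have h := totalDegree_add p q
  set M := max p.totalDegree q.totalDegree + 1 with hM
  rw [expLaplacian_eq_sum Rp κ ω (M := M) (p + q) (by omega),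
    expLaplacian_eq_sum Rp κ ω (M := M) p (by omega),
    expLaplacian_eq_sum Rp κ ω (M := M) q (by omega), ← Finset.sum_add_distrib]
  simp only [map_add, smul_add]

theorem expLaplacian_smul (Rp : Finset (Space N)) (κ : Space N → ℝ) (ω a : ℝ) (p : Poly N) :
    expLaplacian Rp κ ω (a • p) = a • expLaplacian Rp κ ω p := by
  have h := totalDegree_smul_le a p
  set M := p.totalDegree + 1 with hM
  rw [expLaplacian_eq_sum Rp κ ω (M := M) (a • p) (by omega),
    expLaplacian_eq_sum Rp κ ω (M := M) p (by omega), Finset.smul_sum]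
  simp only [map_smul, smul_comm a]

theorem expLaplacian_C (Rp : Finset (Space N)) (κ : Space N → ℝ) (ω a : ℝ) :
    expLaplacian Rp κ ω (C a) = C a := by
  rw [expLaplacian_eq_sum Rp κ ω (M := 1) (C a) (by simp)]
  simp

/-- `expLaplacian` as a linear map. -/
def expLaplacianₗ (Rp : Finset (Space N)) (κ : Space N → ℝ) (ω : ℝ) :
    Module.End ℝ (Poly N) where
  toFun := expLaplacian Rp κ ω
  map_add' := expLaplacian_add Rp κ ω
  map_smul' := expLaplacian_smul Rp κ ω

/-! ### Intertwining relations for the exponential -/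

namespace IsDunklGaussian

variable {Rp : Finset (Space N)} {κ : Space N → ℝ} {ω : ℝ} {L : Poly N →ₗ[ℝ] ℝ}

theorem expLaplacian_dunklOp (hL : IsDunklGaussian Rp κ ω L) (τ : ℝ) (i : Fin N)
    (p : Poly N) :
    expLaplacian Rp κ τ (dunklOp Rp κ i p) = dunklOp Rp κ i (expLaplacian Rp κ τ p) := by
  have h := totalDegree_dunklOp_le Rp κ i p
  set M := p.totalDegree + 1 with hM
  rw [expLaplacian_eq_sum Rp κ τ (M := M) p (by omega),
    expLaplacian_eq_sum Rp κ τ (M := M) _ (by omega), map_sum]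
  refine Finset.sum_congr rfl fun n _ => ?_
  rw [map_smul, ← Module.End.mul_apply, ((hL.commute_dunklLaplacian i).pow_left n).eq,
    Module.End.mul_apply]

theorem expLaplacian_X_mul (hL : IsDunklGaussian Rp κ ω L) {τ : ℝ} (hτ : τ ≠ 0) (i : Fin N)
    (p : Poly N) :
    expLaplacian Rp κ τ (X i * p) = X i * expLaplacian Rp κ τ p +
      (1 / (2 * τ)) • dunklOp Rp κ i (expLaplacian Rp κ τ p) := by
  have h : (X i * p).totalDegree ≤ p.totalDegree + 1 := by
    refine (totalDegree_mul _ _).trans ?_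
    rw [totalDegree_X, add_comm]
  -- The derivative term gets one summand fewer: splitting off n = 0 elsewhere pairs index n + 1
  -- with index n, and the factor 2(n + 1) turns the coefficient at n + 1 into 1/(2τ) times that at
  -- n.
  set M := p.totalDegree + 1 with hM
  rw [expLaplacian_eq_sum Rp κ τ (M := M + 1) _ (by omega)]
  nth_rw 1 [expLaplacian_eq_sum Rp κ τ (M := M + 1) p (by omega)]
  rw [expLaplacian_eq_sum Rp κ τ (M := M) p (by omega), Finset.sum_range_succ',
    Finset.sum_range_succ' _ M, map_sum, mul_add, Finset.smul_sum, Finset.mul_sum, add_right_comm,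
    ← Finset.sum_add_distrib]
  congr 1
  · refine Finset.sum_congr rfl fun n _ => ?_
    rw [hL.dunklLaplacian_pow_X_mul, smul_add, mul_smul_comm, map_smul, smul_smul, smul_smul]
    congr 2
    have : ((n.factorial : ℕ) : ℝ) ≠ 0 := by exact_mod_cast n.factorial_ne_zero
    have h2 : ((n : ℝ) + 1) ≠ 0 := by positivity
    rw [Nat.factorial_succ]
    push_cast
    field_simp
    ring
  · simp

theorem expLaplacian_neg_expLaplacian (hL : IsDunklGaussian Rp κ ω L) (hω : ω ≠ 0)
    (p : Poly N) : expLaplacian Rp κ (-ω) (expLaplacian Rp κ ω p) = p := by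
  induction p using MvPolynomial.induction_on with
  | C a => rw [expLaplacian_C, expLaplacian_C]
  | add p q hp hq => rw [expLaplacian_add, expLaplacian_add, hp, hq]
  | mul_X p i hp =>
    rw [mul_comm p, hL.expLaplacian_X_mul hω, expLaplacian_add, expLaplacian_smul,
      hL.expLaplacian_X_mul (neg_ne_zero.mpr hω), hL.expLaplacian_dunklOp, hp, add_assoc,
      ← add_smul]
    have : 1 / (2 * -ω) + 1 / (2 * ω) = 0 := by field_simp; ring
    rw [this, zero_smul, add_zero]

/-! ### The algebraic pairing -/

theorem L_expLaplacian_X_mul (hL : IsDunklGaussian Rp κ ω L) (hω : ω ≠ 0) (i : Fin N)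
    (p q : Poly N) :
    L (expLaplacian Rp κ (-ω) (X i * p) * expLaplacian Rp κ (-ω) q) =
      L (expLaplacian Rp κ (-ω) p *
        expLaplacian Rp κ (-ω) (((1 / (2 * ω)) • dunklOp Rp κ i) q)) := by
  have h := hL.parts i (expLaplacian Rp κ (-ω) p) (expLaplacian Rp κ (-ω) q)
  rw [hL.expLaplacian_X_mul (neg_ne_zero.mpr hω), LinearMap.smul_apply, expLaplacian_smul,
    hL.expLaplacian_dunklOp, add_mul, map_add, smul_mul_assoc, mul_smul_comm, map_smul,
    map_smul, mul_assoc (X i)]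
  simp only [smul_eq_mul]
  field_simp
  linear_combination -h

theorem L_expLaplacian_eq_eval (hL : IsDunklGaussian Rp κ ω L) (hω : ω ≠ 0) (p : Poly N) :
    L (expLaplacian Rp κ (-ω) p) = L 1 * eval 0 p := by
  induction p using MvPolynomial.induction_on with
  | C a => rw [expLaplacian_C, ← mul_one (C a), ← smul_eq_C_mul, map_smul]; simp [mul_comm]
  | add p q hp hq => rw [expLaplacian_add, map_add, hp, hq, map_add, mul_add]
  | mul_X p i hp =>
    -- Against q = 1 the adjoint relation gives zero, because D_i 1 = 0.
    have h := hL.L_expLaplacian_X_mul hω i p 1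
    have h1 : ∀ τ, expLaplacian Rp κ τ 1 = 1 := fun τ => by
      simpa using expLaplacian_C Rp κ τ 1
    have h2 : dunklOp Rp κ i 1 = 0 := by simpa using dunklOp_C Rp κ i 1
    have h3 : expLaplacian Rp κ (-ω) 0 = 0 := by simpa using expLaplacian_C Rp κ (-ω) 0
    rw [h1, mul_one, LinearMap.smul_apply, h2, smul_zero, h3, mul_zero, map_zero] at h
    rw [mul_comm p, h]
    simp

theorem L_expLaplacian_mul (hL : IsDunklGaussian Rp κ ω L) (hω : ω ≠ 0) (p q : Poly N) :
    L (expLaplacian Rp κ (-ω) p * expLaplacian Rp κ (-ω) q) =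
      L 1 * algPairing Rp κ ω p q := by
  set A : Fin N → Module.End ℝ (Poly N) := fun i => (1 / (2 * ω)) • dunklOp Rp κ i with hA
  set E := expLaplacianₗ Rp κ (-ω) with hE
  have hEa : ∀ p, expLaplacian Rp κ (-ω) p = E p := fun _ => rfl
  simp only [hEa]
  have hpow : ∀ (i : Fin N) (n : ℕ) (p q : Poly N),
      L (E (X i ^ n * p) * E q) = L (E p * E ((A i ^ n) q)) := by
    intro i n
    induction n with
    | zero => intro p q; simp
    | succ n ih =>
      intro p q
      rw [pow_succ', mul_assoc, ← hEa, ← hEa, hL.L_expLaplacian_X_mul hω, hEa, hEa, ih,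
        pow_succ, Module.End.mul_apply]
  have hlist : ∀ (l : List (Fin N × ℕ)) (p q : Poly N),
      L (E ((l.map fun a => X a.1 ^ a.2).prod * p) * E q) =
        L (E p * E ((l.map fun a => A a.1 ^ a.2).prod q)) := by
    intro l
    induction l with
    | nil => intro p q; simp
    | cons a l ih =>
      intro p q
      -- The tail is moved across before the head, so the operators arrive in exactly the order used
      -- by `polyOp`.
      rw [List.map_cons, List.map_cons, List.prod_cons, List.prod_cons, mul_assoc, mul_left_comm,
        ih, hpow, Module.End.mul_apply]
  have hmon : ∀ α : Fin N →₀ ℕ, L (E (monomial α 1) * E q) =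
      L (E ((List.ofFn fun i => A i ^ α i).prod q)) := by
    intro α
    have h := hlist (List.ofFn fun i => (i, α i)) 1 q
    have h1 : E 1 = 1 := by simpa [← hEa] using expLaplacian_C Rp κ (-ω) 1
    rw [List.map_ofFn, List.map_ofFn, List.prod_ofFn, mul_one, h1, one_mul] at h
    rw [monomial_eq, Finsupp.prod_fintype _ _ (fun _ => pow_zero _)]
    simpa [Function.comp_def] using h
  have hsum : L (E p * E q) = L (E (polyOp A p q)) := by
    nth_rw 1 [p.as_sum]
    simp only [polyOp, LinearMap.sum_apply, LinearMap.smul_apply, map_sum, map_smul,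
      Finset.sum_mul]
    refine Finset.sum_congr rfl fun α _ => ?_
    have : monomial α (coeff α p) = coeff α p • monomial α (1 : ℝ) := by
      rw [smul_monomial, smul_eq_mul, mul_one]
    rw [← hmon, this, map_smul, smul_mul_assoc, map_smul]
  rw [hsum, ← hEa, hL.L_expLaplacian_eq_eval hω]
  rfl

theorem algPairing_expLaplacian (hL : IsDunklGaussian Rp κ ω L) (hω : ω ≠ 0)
    (p q : Poly N) :
    L 1 * algPairing Rp κ ω (expLaplacian Rp κ ω p) (expLaplacian Rp κ ω q) = L (p * q) := by
  rw [← hL.L_expLaplacian_mul hω, hL.expLaplacian_neg_expLaplacian hω,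
    hL.expLaplacian_neg_expLaplacian hω]

end IsDunklGaussian

/-! ### Polynomials times Gaussians -/

theorem continuous_eval_space (p : Poly N) : Continuous fun x : Space N => eval (fun i => x i) p :=
  (MvPolynomial.continuous_eval p).comp (by fun_prop)

theorem integrable_pow_mul_gaussian {ω : ℝ} (hω : 0 < ω) (n : ℕ) :
    Integrable fun x : ℝ => x ^ n * Real.exp (-ω * x ^ 2) := by
  simpa [Real.rpow_natCast] using
    integrable_rpow_mul_exp_neg_mul_sq hω (s := n) (by linarith [n.cast_nonneg (α := ℝ)])

theorem integrable_eval_mul_gaussian {ω : ℝ} (hω : 0 < ω) (p : Poly N) :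
    Integrable fun x : Space N => eval (fun i => x i) p * Real.exp (-ω * ‖x‖ ^ 2) := by
  induction p using MvPolynomial.induction_on' with
  | monomial α a =>
    have h := (Integrable.fintype_prod (μ := fun _ : Fin N => (volume : Measure ℝ))
      fun i => integrable_pow_mul_gaussian hω (α i)).const_mul a
    have h2 := (PiLp.volume_preserving_ofLp (Fin N)).integrable_comp_of_integrable h
    refine h2.congr (Filter.Eventually.of_forall fun x => ?_)
    simp only [Function.comp_apply]
    rw [Finset.prod_mul_distrib, eval_monomial, Finsupp.prod_fintype _ _ (fun _ => pow_zero _),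
      EuclideanSpace.norm_sq_eq, ← Real.exp_sum, Finset.mul_sum, mul_assoc]
    simp
  | add p q hp hq =>
    simp only [map_add, add_mul]
    exact hp.add hq

/-! ### The regularized weight -/

/-- The regularization `∏_{v ∈ R₊} (⟨x, v⟩² + ε)^{κ_v}` of `h_κ(x)²`, times `exp(-ω|x|²)`. -/
def regDensity (Rp : Finset (Space N)) (κ : Space N → ℝ) (ω ε : ℝ) (x : Space N) : ℝ :=
  Real.exp (-ω * ‖x‖ ^ 2) * ∏ v ∈ Rp, (inner ℝ x v ^ 2 + ε) ^ κ v

theorem regDensity_zero (Rp : Finset (Space N)) (κ : Space N → ℝ) (ω : ℝ) (x : Space N) :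
    regDensity Rp κ ω 0 x = Real.exp (-ω * ‖x‖ ^ 2) * weight Rp κ x ^ 2 := by
  rw [regDensity, weight, ← Finset.prod_pow]
  congr 1
  refine Finset.prod_congr rfl fun v _ => ?_
  rw [add_zero, ← sq_abs, pow_two, Real.mul_rpow (abs_nonneg _) (abs_nonneg _), pow_two]

theorem regDensity_nonneg (Rp : Finset (Space N)) (κ : Space N → ℝ) (ω : ℝ) {ε : ℝ}
    (hε : 0 ≤ ε) (x : Space N) : 0 ≤ regDensity Rp κ ω ε x :=
  mul_nonneg (Real.exp_pos _).le
    (Finset.prod_nonneg fun _ _ => Real.rpow_nonneg (by positivity) _)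

/-- Nonnegative exponents keep the powers continuous at base zero, so ε = 0 is included. -/
theorem continuous_regDensity {Rp : Finset (Space N)} {κ : Space N → ℝ}
    (hκ : ∀ v ∈ Rp, 0 ≤ κ v) (ω : ℝ) : Continuous fun z : ℝ × Space N =>
      regDensity Rp κ ω z.1 z.2 := by
  unfold regDensity
  refine Continuous.mul (by fun_prop) (continuous_finsetProd _ fun v hv => ?_)
  exact Continuous.rpow_const (by fun_prop) fun _ => Or.inr (hκ v hv)

theorem continuous_regDensity_right {Rp : Finset (Space N)} {κ : Space N → ℝ}
    (hκ : ∀ v ∈ Rp, 0 ≤ κ v) (ω ε : ℝ) : Continuous (regDensity Rp κ ω ε) :=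
  (continuous_regDensity hκ ω).comp (f := fun x => (ε, x)) (by fun_prop)

/-- A polynomial that dominates the regularized weights. -/
def weightBound (Rp : Finset (Space N)) (κ : Space N → ℝ) : Poly N :=
  ∏ v ∈ Rp, (linForm v ^ 2 + 1) ^ ⌈κ v⌉₊

theorem regDensity_le {Rp : Finset (Space N)} {κ : Space N → ℝ} (hκ : ∀ v ∈ Rp, 0 ≤ κ v)
    (ω : ℝ) {ε : ℝ} (hε : ε ∈ Set.Icc 0 1) (x : Space N) :
    regDensity Rp κ ω ε x ≤
      eval (fun i => x i) (weightBound Rp κ) * Real.exp (-ω * ‖x‖ ^ 2) := by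
  have hε0 := hε.1
  rw [regDensity, mul_comm, weightBound, map_prod]
  refine mul_le_mul_of_nonneg_right (Finset.prod_le_prod (fun v _ => ?_) fun v hv => ?_)
    (Real.exp_pos _).le
  · exact Real.rpow_nonneg (by positivity) _
  · rw [map_pow, map_add, map_pow, eval_linForm, map_one, ← Real.rpow_natCast _ ⌈κ v⌉₊]
    have h1 : inner ℝ x v ^ 2 + ε ≤ inner ℝ x v ^ 2 + 1 := by linarith [hε.2]
    refine (Real.rpow_le_rpow (by positivity) h1 (hκ v hv)).trans ?_
    exact Real.rpow_le_rpow_of_exponent_le (le_add_of_nonneg_left (sq_nonneg _)) (Nat.le_ceil _)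

theorem integrable_of_abs_le {Rp : Finset (Space N)} {κ : Space N → ℝ}
    (hκ : ∀ v ∈ Rp, 0 ≤ κ v) {ω : ℝ} (hω : 0 < ω) {ε : ℝ} (hε : ε ∈ Set.Icc 0 1) (p : Poly N)
    {F : Space N → ℝ} (hF : Continuous F)
    (hle : ∀ x, |F x| ≤ |eval (fun i => x i) p| ) :
    Integrable fun x => F x * regDensity Rp κ ω ε x := by
  refine Integrable.mono' (integrable_eval_mul_gaussian hω (p * weightBound Rp κ)).norm
    (hF.mul (continuous_regDensity_right hκ ω ε)).aestronglyMeasurable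
    (Filter.Eventually.of_forall fun x => ?_)
  rw [map_mul, mul_assoc, norm_mul, norm_mul]
  gcongr
  · exact hle x
  · rw [Real.norm_of_nonneg (regDensity_nonneg Rp κ ω hε.1 x)]
    exact (regDensity_le hκ ω hε x).trans (le_abs_self _)

theorem integrable_eval_mul_regDensity {Rp : Finset (Space N)} {κ : Space N → ℝ}
    (hκ : ∀ v ∈ Rp, 0 ≤ κ v) {ω : ℝ} (hω : 0 < ω) {ε : ℝ} (hε : ε ∈ Set.Icc 0 1) (p : Poly N) :
    Integrable fun x : Space N => eval (fun i => x i) p * regDensity Rp κ ω ε x :=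
  integrable_of_abs_le hκ hω hε p (continuous_eval_space p) fun _ => le_rfl

/-- Dominated convergence of the regularized integrals. -/
theorem tendsto_integral_regDensity {Rp : Finset (Space N)} {κ : Space N → ℝ}
    (hκ : ∀ v ∈ Rp, 0 ≤ κ v) {ω : ℝ} (hω : 0 < ω) (p : Poly N) {F : ℝ → Space N → ℝ}
    (hF : ∀ ε > 0, Continuous (F ε))
    (hle : ∀ ε > 0, ∀ x, |F ε x| ≤ |eval (fun i => x i) p|)
    (hlim : ∀ᵐ x, Filter.Tendsto (fun ε => F ε x) (nhdsWithin 0 (Set.Ioi 0))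
      (nhds (eval (fun i => x i) p))) :
    Filter.Tendsto (fun ε => ∫ x, F ε x * regDensity Rp κ ω ε x) (nhdsWithin 0 (Set.Ioi 0))
      (nhds (∫ x, eval (fun i => x i) p * regDensity Rp κ ω 0 x)) := by
  refine tendsto_integral_filter_of_dominated_convergence
    (fun x => ‖eval (fun i => x i) (p * weightBound Rp κ) * Real.exp (-ω * ‖x‖ ^ 2)‖) ?_ ?_
    (integrable_eval_mul_gaussian hω (p * weightBound Rp κ)).norm ?_
  · filter_upwards [self_mem_nhdsWithin] with ε hε
    exact ((hF ε hε).mul (continuous_regDensity_right hκ ω ε)).aestronglyMeasurable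
  · filter_upwards [Ioo_mem_nhdsGT (zero_lt_one (α := ℝ))] with ε hε
    refine Filter.Eventually.of_forall fun x => ?_
    have hε' : ε ∈ Set.Icc (0 : ℝ) 1 := ⟨hε.1.le, hε.2.le⟩
    rw [map_mul, mul_assoc, norm_mul, norm_mul]
    gcongr
    · exact hle ε hε.1 x
    · rw [Real.norm_of_nonneg (regDensity_nonneg Rp κ ω hε'.1 x)]
      exact (regDensity_le hκ ω hε' x).trans (le_abs_self _)
  · filter_upwards [hlim] with x hx
    refine hx.mul (tendsto_nhdsWithin_of_tendsto_nhds ?_)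
    exact ((continuous_regDensity hκ ω).comp
      (g := fun z : ℝ × Space N => regDensity Rp κ ω z.1 z.2)
      (Continuous.prodMk_left x)).tendsto 0

/-! ### Integration by parts for the regularized density -/

theorem hasLineDerivAt_eval (p : Poly N) (i : Fin N) (x : Space N) :
    HasLineDerivAt ℝ (fun x : Space N => eval (fun i => x i) p)
      (eval (fun i => x i) (pderiv i p)) x (EuclideanSpace.single i 1) := by
  unfold HasLineDerivAt
  induction p using MvPolynomial.induction_on with
  | C a => simpa using hasDerivAt_const (0 : ℝ) a
  | add p q hp hq => simpa using hp.fun_add hq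
  | mul_X p j hp =>
    have hX : HasDerivAt (fun t : ℝ => (x + t • EuclideanSpace.single i (1 : ℝ)) j)
        ((Pi.single i 1 : Fin N → ℝ) j) 0 := by
      have h := ((hasDerivAt_id (0 : ℝ)).mul_const
        ((Pi.single i 1 : Fin N → ℝ) j)).const_add (x j)
      rw [one_mul] at h
      exact h
    have h := hp.fun_mul hX
    simp only [map_mul, eval_X, Derivation.leibniz, pderiv_X, smul_eq_mul, map_add]
    refine h.congr_deriv ?_
    by_cases hij : i = j
    · subst hij; simp; ring
    · simp [Ne.symm hij]; ring

theorem regDensity_eq_exp (Rp : Finset (Space N)) (κ : Space N → ℝ) (ω : ℝ) {ε : ℝ}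
    (hε : 0 < ε) (x : Space N) :
    regDensity Rp κ ω ε x =
      Real.exp (-ω * ‖x‖ ^ 2 + ∑ v ∈ Rp, Real.log (inner ℝ x v ^ 2 + ε) * κ v) := by
  rw [regDensity, Real.exp_add, Real.exp_sum]
  congr 1
  exact Finset.prod_congr rfl fun v _ => Real.rpow_def_of_pos (by positivity) _

theorem hasLineDerivAt_regDensity (Rp : Finset (Space N)) (κ : Space N → ℝ) (ω : ℝ) {ε : ℝ}
    (hε : 0 < ε) (i : Fin N) (x : Space N) :
    HasLineDerivAt ℝ (regDensity Rp κ ω ε)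
      (regDensity Rp κ ω ε x * (-2 * ω * x i +
        ∑ v ∈ Rp, κ v * v i * (2 * (inner ℝ x v / (inner ℝ x v ^ 2 + ε))))) x
      (EuclideanSpace.single i 1) := by
  unfold HasLineDerivAt
  simp only [regDensity_eq_exp Rp κ ω hε]
  have hid := hasDerivAt_id (0 : ℝ)
  have h1 : HasDerivAt (fun t : ℝ => ‖x + t • EuclideanSpace.single i (1 : ℝ)‖ ^ 2)
      (2 * x i) 0 := by
    have : ∀ t : ℝ, ‖x + t • EuclideanSpace.single i (1 : ℝ)‖ ^ 2 =
        ‖x‖ ^ 2 + t * (2 * x i) + t ^ 2 := fun t => by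
      rw [norm_add_sq_real, norm_smul, inner_smul_right, EuclideanSpace.inner_single_right]
      simp
      ring
    simp only [this]
    simpa using ((hid.mul_const (2 * x i)).const_add (‖x‖ ^ 2)).fun_add (hid.fun_pow 2)
  have h2 : ∀ v : Space N, HasDerivAt
      (fun t : ℝ => Real.log (inner ℝ (x + t • EuclideanSpace.single i (1 : ℝ)) v ^ 2 + ε))
      (2 * inner ℝ x v * v i / (inner ℝ x v ^ 2 + ε)) 0 := fun v => by
    have : ∀ t : ℝ, inner ℝ (x + t • EuclideanSpace.single i (1 : ℝ)) v =
        inner ℝ x v + t * v i := fun t => by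
      rw [inner_add_left, real_inner_smul_left, EuclideanSpace.inner_single_left]
      simp
    simp only [this]
    have h3 := (((hid.mul_const (v i)).const_add (inner ℝ x v)).fun_pow 2).add_const ε
    have h4 := h3.log (by simp; positivity)
    simpa using h4
  have h := ((h1.const_mul (-ω)).fun_add
    (HasDerivAt.fun_sum fun v (_ : v ∈ Rp) => (h2 v).mul_const (κ v))).exp
  refine h.congr_deriv ?_
  simp only [zero_smul, add_zero]
  congr 2
  · ring
  · exact Finset.sum_congr rfl fun v _ => by ring

theorem integral_lineDeriv_eq_zero {F F' : Space N → ℝ} {v : Space N}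
    (hF : ∀ x, HasLineDerivAt ℝ F (F' x) x v) (hi : Integrable F) (hi' : Integrable F') :
    ∫ x, F' x = 0 := by
  have h := integral_bilinear_hasLineDerivAt_right_eq_neg_left_of_integrable
    (μ := (volume : Measure (Space N))) (f := fun _ => (1 : ℝ)) (f' := fun _ => (0 : ℝ))
    (g := F) (g' := F') (v := v) (B := ContinuousLinearMap.mul ℝ ℝ) (by simp)
    (by simpa using hi') (by simpa using hi)
    (fun x _ => by simpa [HasLineDerivAt] using hasDerivAt_const (0 : ℝ) (1 : ℝ))
    (fun x _ => hF x)
  simpa using h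

theorem integrable_kernel {Rp : Finset (Space N)} {κ : Space N → ℝ}
    (hκ : ∀ v ∈ Rp, 0 ≤ κ v) {ω : ℝ} (hω : 0 < ω) {ε : ℝ} (hε : ε ∈ Set.Ioc 0 1)
    (v : Space N) (p : Poly N) :
    Integrable fun x : Space N => eval (fun i => x i) p *
        (inner ℝ x v / (inner ℝ x v ^ 2 + ε)) * regDensity Rp κ ω ε x := by
  have hε0 := hε.1
  -- The crude bound |⟨x,v⟩|/ε on the kernel suffices, since ε is fixed here.
  refine integrable_of_abs_le hκ hω ⟨hε.1.le, hε.2⟩ (p * (linForm v * C (1 / ε))) ?_ fun x => ?_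
  · refine (continuous_eval_space p).mul (Continuous.div (by fun_prop) (by fun_prop) fun x => ?_)
    positivity
  · rw [map_mul, map_mul, eval_linForm, eval_C, abs_mul, abs_mul, abs_mul, abs_div,
      abs_of_pos (show 0 < inner ℝ x v ^ 2 + ε by positivity),
      abs_of_pos (show 0 < 1 / ε by positivity), mul_one_div]
    gcongr
    exact le_add_of_nonneg_left (sq_nonneg _)

/-- Integration by parts against the regularized density. -/
theorem integral_pderiv_regDensity {Rp : Finset (Space N)} {κ : Space N → ℝ}
    (hκ : ∀ v ∈ Rp, 0 ≤ κ v) {ω : ℝ} (hω : 0 < ω) {ε : ℝ} (hε : ε ∈ Set.Ioc 0 1)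
    (i : Fin N) (f : Poly N) :
    (∫ x : Space N, eval (fun i => x i) (pderiv i f) * regDensity Rp κ ω ε x) +
      ∑ v ∈ Rp, κ v * v i * ∫ x : Space N, eval (fun i => x i) ((2 : ℝ) • f) *
        (inner ℝ x v / (inner ℝ x v ^ 2 + ε)) * regDensity Rp κ ω ε x =
    2 * ω * ∫ x : Space N, eval (fun i => x i) (X i * f) * regDensity Rp κ ω ε x := by
  have hε' : ε ∈ Set.Icc (0 : ℝ) 1 := ⟨hε.1.le, hε.2⟩
  have hε0 := hε.1
  have hi : ∀ v : Space N, Integrable fun x : Space N => eval (fun i => x i) ((2 : ℝ) • f) *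
        (inner ℝ x v / (inner ℝ x v ^ 2 + ε)) * regDensity Rp κ ω ε x := fun v =>
    integrable_kernel hκ hω hε v _
  have h1 := integrable_eval_mul_regDensity hκ hω hε' (pderiv i f)
  have h2 := integrable_eval_mul_regDensity hκ hω hε' (X i * f)
  have h3 : Integrable fun x : Space N => ∑ v ∈ Rp, κ v * v i *
      (eval (fun i => x i) ((2 : ℝ) • f) *
        (inner ℝ x v / (inner ℝ x v ^ 2 + ε)) * regDensity Rp κ ω ε x) :=
    integrable_finsetSum _ fun v _ => (hi v).const_mul _
  have hF : ∀ x, HasLineDerivAt ℝ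
      (fun x : Space N => eval (fun i => x i) f * regDensity Rp κ ω ε x)
      (eval (fun i => x i) (pderiv i f) * regDensity Rp κ ω ε x +
        (∑ v ∈ Rp, κ v * v i * (eval (fun i => x i) ((2 : ℝ) • f) *
          (inner ℝ x v / (inner ℝ x v ^ 2 + ε)) * regDensity Rp κ ω ε x)) -
        2 * ω * (eval (fun i => x i) (X i * f) * regDensity Rp κ ω ε x)) x
      (EuclideanSpace.single i 1) := by
    intro x
    have h := HasDerivAt.fun_mul (hasLineDerivAt_eval f i x)
      (hasLineDerivAt_regDensity Rp κ ω hε0 i x)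
    unfold HasLineDerivAt
    refine h.congr_deriv ?_
    simp only [zero_smul, add_zero, map_mul, smul_eval, eval_X]
    rw [mul_add (regDensity Rp κ ω ε x), mul_add, Finset.mul_sum, Finset.mul_sum]
    rw [Finset.sum_congr rfl fun v _ => show κ v * v i * (2 * eval (fun i => x i) f *
      (inner ℝ x v / (inner ℝ x v ^ 2 + ε)) * regDensity Rp κ ω ε x) =
      eval (fun i => x i) f * (regDensity Rp κ ω ε x *
        (κ v * v i * (2 * (inner ℝ x v / (inner ℝ x v ^ 2 + ε))))) by ring]
    ring
  have key := integral_lineDeriv_eq_zero hF (integrable_eval_mul_regDensity hκ hω hε' f)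
    ((h1.add h3).sub (h2.const_mul (2 * ω)))
  have h13 := integral_sub (h1.add h3) (h2.const_mul (2 * ω))
  simp only [Pi.add_apply] at h13
  rw [h13, integral_add h1 h3, integral_finsetSum _ fun v _ => (hi v).const_mul _] at key
  simp only [integral_const_mul] at key
  linarith

/-! ### Reflection invariance of the density -/

theorem refl_self (v : Space N) : refl v v = -v :=
  Submodule.reflection_orthogonalComplement_singleton_eq_neg v

theorem refl_refl (v x : Space N) : refl v (refl v x) = x := by simp [refl]

theorem inner_refl_left (v x y : Space N) : inner ℝ (refl v x) y = inner ℝ x (refl v y) := by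
  rw [← (refl v).inner_map_map, refl_refl]

theorem neg_mem_of_mem {R : Finset (Space N)} (hR : IsReducedRootSystem R) {v : Space N}
    (hv : v ∈ R) : -v ∈ R := by
  simpa [refl_self] using hR.refl_mem v hv v hv

theorem multiplicity_refl {R : Finset (Space N)} {κ : Space N → ℝ} (hκ : IsMultiplicity R κ)
    {u v : Space N} (hu : u ∈ R) (hv : v ∈ R) : κ (refl v u) = κ u :=
  hκ u hu _ (Subgroup.subset_closure ⟨v, hv, rfl⟩)

theorem mem_posRoots {R : Finset (Space N)} {u₀ v : Space N} :
    v ∈ posRoots R u₀ ↔ v ∈ R ∧ 0 < inner ℝ u₀ v := by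
  simp [posRoots]

theorem prod_posRoots_sq {R : Finset (Space N)} (hR : IsReducedRootSystem R) {u₀ : Space N}
    (hu₀ : ∀ v ∈ R, inner ℝ u₀ v ≠ 0) (g : Space N → ℝ) (hg : ∀ v ∈ R, g (-v) = g v) :
    (∏ v ∈ posRoots R u₀, g v) ^ 2 = ∏ v ∈ R, g v := by
  classical
  rw [← Finset.prod_filter_mul_prod_filter_not R (fun v => 0 < inner ℝ u₀ v), pow_two]
  have h1 : posRoots R u₀ = R.filter fun v => 0 < inner ℝ u₀ v := by
    ext v; simp [mem_posRoots]
  rw [h1]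
  congr 1
  refine Finset.prod_bij' (fun v _ => -v) (fun v _ => -v) ?_ ?_ (by simp) (by simp) ?_
  · intro v hv
    rw [Finset.mem_filter] at hv ⊢
    refine ⟨neg_mem_of_mem hR hv.1, ?_⟩
    rw [inner_neg_right]
    linarith [hv.2]
  · intro v hv
    rw [Finset.mem_filter] at hv ⊢
    refine ⟨neg_mem_of_mem hR hv.1, ?_⟩
    rw [inner_neg_right, neg_pos]
    exact lt_of_le_of_ne (not_lt.mp hv.2) (hu₀ v hv.1)
  · intro v hv
    exact (hg v (Finset.mem_filter.mp hv).1).symm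

/-- A reflection need not preserve the positive roots, but it permutes R. The square of the product
over positive roots is the product over R, and nonnegativity allows the square root to be taken. -/
theorem prod_posRoots_refl {R : Finset (Space N)} (hR : IsReducedRootSystem R) {u₀ : Space N}
    (hu₀ : ∀ v ∈ R, inner ℝ u₀ v ≠ 0) (g : Space N → ℝ) (hg : ∀ v ∈ R, g (-v) = g v)
    (hg0 : ∀ v ∈ R, 0 ≤ g v) {v : Space N} (hv : v ∈ R) :
    ∏ u ∈ posRoots R u₀, g (refl v u) = ∏ u ∈ posRoots R u₀, g u := by
  have hmem : ∀ u ∈ posRoots R u₀, u ∈ R := fun u hu => (mem_posRoots.mp hu).1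
  refine (pow_left_inj₀ (Finset.prod_nonneg fun u hu => hg0 _ (hR.refl_mem u (hmem u hu) v hv))
    (Finset.prod_nonneg fun u hu => hg0 _ (hmem u hu)) two_ne_zero).mp ?_
  rw [prod_posRoots_sq hR hu₀ _ hg, prod_posRoots_sq hR hu₀ (fun u => g (refl v u))
    fun u hu => by rw [map_neg, hg _ (hR.refl_mem u hu v hv)]]
  exact Finset.prod_bij' (fun u _ => refl v u) (fun u _ => refl v u)
    (fun u hu => hR.refl_mem u hu v hv) (fun u hu => hR.refl_mem u hu v hv)
    (fun u _ => refl_refl v u) (fun u _ => refl_refl v u) fun u _ => rfl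

theorem regDensity_refl {R : Finset (Space N)} (hR : IsReducedRootSystem R) {u₀ : Space N}
    (hu₀ : ∀ v ∈ R, inner ℝ u₀ v ≠ 0) {κ : Space N → ℝ} (hκ : IsMultiplicity R κ) (ω : ℝ)
    {ε : ℝ} (hε : 0 ≤ ε) {v : Space N} (hv : v ∈ R) (x : Space N) :
    regDensity (posRoots R u₀) κ ω ε (refl v x) = regDensity (posRoots R u₀) κ ω ε x := by
  rw [regDensity, regDensity, LinearIsometryEquiv.norm_map,
    ← prod_posRoots_refl hR hu₀ (fun u => (inner ℝ x u ^ 2 + ε) ^ κ u) (fun u hu => ?_)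
      (fun u _ => by positivity) hv]
  · congr 1
    refine Finset.prod_congr rfl fun u hu => ?_
    rw [inner_refl_left, multiplicity_refl hκ (mem_posRoots.mp hu).1 hv]
  · have : κ (-u) = κ u := by rw [← multiplicity_refl hκ hu hu, refl_self]
    rw [inner_neg_right, neg_sq, this]

theorem integral_comp_refl (v : Space N) (F : Space N → ℝ) :
    ∫ x, F (refl v x) = ∫ x, F x :=
  (refl v).measurePreserving.integral_comp (refl v).toHomeomorph.measurableEmbedding F

/-! ### The Gaussian functional -/

/-- The reflected part of the difference quotients contributes nothing, by oddness. -/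
theorem integral_kernel {R : Finset (Space N)} (hR : IsReducedRootSystem R) {u₀ : Space N}
    (hu₀ : ∀ v ∈ R, inner ℝ u₀ v ≠ 0) {κ : Space N → ℝ} (hκ : IsMultiplicity R κ)
    (hκ0 : ∀ v ∈ R, 0 ≤ κ v) {ω : ℝ} (hω : 0 < ω) {ε : ℝ} (hε : ε ∈ Set.Ioc 0 1)
    {v : Space N} (hv : v ∈ R) (p q : Poly N) :
    ∫ x : Space N, eval (fun i => x i) ((2 : ℝ) • (p * q)) *
        (inner ℝ x v / (inner ℝ x v ^ 2 + ε)) * regDensity (posRoots R u₀) κ ω ε x =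
      ∫ x : Space N, eval (fun i => x i) (divDiff v p * q + p * divDiff v q) *
        (inner ℝ x v ^ 2 / (inner ℝ x v ^ 2 + ε)) * regDensity (posRoots R u₀) κ ω ε x := by
  set Rp := posRoots R u₀ with hRp
  have hκp : ∀ u ∈ Rp, 0 ≤ κ u := fun u hu => hκ0 u (mem_posRoots.mp hu).1
  have hodd : ∫ x : Space N, eval (fun i => x i) (reflPoly v p * q + p * reflPoly v q) *
      (inner ℝ x v / (inner ℝ x v ^ 2 + ε)) * regDensity Rp κ ω ε x = 0 := by
    -- Under x ↦ xσ_v the polynomial factor and the density are invariant while the kernel changes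
    -- sign.
    rw [← self_eq_neg, ← integral_neg, ← integral_comp_refl v]
    refine integral_congr_ae (Filter.Eventually.of_forall fun x => ?_)
    simp only [regDensity_refl hR hu₀ hκ ω hε.1.le hv, hRp, inner_refl_left, refl_self,
      inner_neg_right, ← eval_reflPoly, map_add, map_mul, reflPoly_reflPoly]
    ring
  rw [← sub_zero (∫ x : Space N, eval (fun i => x i) ((2 : ℝ) • (p * q)) * _ * _), ← hodd,
    ← integral_sub (integrable_kernel hκp hω hε v _) (integrable_kernel hκp hω hε v _)]
  refine integral_congr_ae (Filter.Eventually.of_forall fun x => ?_)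
  have h1 := congrArg (eval fun i => x i) (linForm_mul_divDiff (hR.ne_zero v hv) p)
  have h2 := congrArg (eval fun i => x i) (linForm_mul_divDiff (hR.ne_zero v hv) q)
  simp only [map_mul, map_sub, eval_linForm] at h1 h2
  simp only [smul_eval, map_add, map_mul, pow_two (inner ℝ x v), div_eq_mul_inv]
  linear_combination (-(inner ℝ x v * (inner ℝ x v * inner ℝ x v + ε)⁻¹ *
    regDensity Rp κ ω ε x)) * (eval (fun i => x i) q * h1 + eval (fun i => x i) p * h2)

theorem ae_inner_ne_zero {v : Space N} (hv : v ≠ 0) :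
    ∀ᵐ x : Space N, inner ℝ x v ≠ 0 := by
  have h := Measure.addHaar_submodule (volume : Measure (Space N)) (ℝ ∙ v)ᗮ fun h => hv <| by
    have : v ∈ (ℝ ∙ v)ᗮ := h ▸ Submodule.mem_top
    rwa [Submodule.mem_orthogonal_singleton_iff_inner_left, inner_self_eq_zero] at this
  rw [ae_iff]
  convert h using 2
  ext x
  simp [Submodule.mem_orthogonal_singleton_iff_inner_left]

/-- The functional `p ↦ ∫ p(x) exp(-ω|x|²) h_κ(x)² dx`. -/
def gaussFunctional {Rp : Finset (Space N)} {κ : Space N → ℝ} (hκ : ∀ v ∈ Rp, 0 ≤ κ v) {ω : ℝ}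
    (hω : 0 < ω) : Poly N →ₗ[ℝ] ℝ where
  toFun p := ∫ x : Space N, eval (fun i => x i) p * regDensity Rp κ ω 0 x
  map_add' p q := by
    simp only [map_add, add_mul]
    exact integral_add (integrable_eval_mul_regDensity hκ hω (by simp) p)
      (integrable_eval_mul_regDensity hκ hω (by simp) q)
  map_smul' a p := by
    simp only [smul_eval, mul_assoc, integral_const_mul, RingHom.id_apply, smul_eq_mul]

theorem gaussFunctional_apply {Rp : Finset (Space N)} {κ : Space N → ℝ}
    (hκ : ∀ v ∈ Rp, 0 ≤ κ v) {ω : ℝ} (hω : 0 < ω) (p : Poly N) : gaussFunctional hκ hω p =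
      ∫ x : Space N, eval (fun i => x i) p * regDensity Rp κ ω 0 x := rfl

theorem gaussFunctional_definite {Rp : Finset (Space N)} {κ : Space N → ℝ}
    (hRp : ∀ v ∈ Rp, v ≠ 0) (hκ : ∀ v ∈ Rp, 0 ≤ κ v) {ω : ℝ} (hω : 0 < ω) (p : Poly N)
    (h : gaussFunctional hκ hω (p * p) = 0) : p = 0 := by
  have hi := integrable_eval_mul_regDensity hκ hω (ε := 0) (by simp) (p * p)
  have hc : Continuous fun x : Space N =>
      eval (fun i => x i) (p * p) * regDensity Rp κ ω 0 x :=
    (continuous_eval_space _).mul (continuous_regDensity_right hκ ω 0)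
  have h0 : 0 ≤ fun x : Space N => eval (fun i => x i) (p * p) * regDensity Rp κ ω 0 x :=
    fun x => mul_nonneg (by rw [map_mul]; exact mul_self_nonneg _)
      (regDensity_nonneg Rp κ ω le_rfl x)
  have hz := (hc.ae_eq_iff_eq volume continuous_const).mp
    ((integral_eq_zero_iff_of_nonneg h0 hi).mp h)
  -- By continuity the integrand vanishes everywhere, and the density can vanish only on a mirror;
  -- multiplying by all the linear forms covers the mirrors too.
  have hprod : p * ∏ v ∈ Rp, linForm v = 0 := by
    refine poly_ext fun x => ?_
    have hx : eval (fun i => x i) (p * p) * regDensity Rp κ ω 0 x = 0 := congrFun hz x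
    simp only [map_mul, map_prod, eval_linForm, map_zero, mul_eq_zero, regDensity,
      or_self, Real.exp_ne_zero, false_or, Finset.prod_eq_zero_iff, add_zero] at hx ⊢
    refine hx.imp_right fun ⟨v, hv, hvx⟩ => ⟨v, hv, ?_⟩
    rw [Real.rpow_eq_zero_iff_of_nonneg (sq_nonneg _)] at hvx
    simpa using hvx.1
  refine (mul_eq_zero.mp hprod).resolve_right ?_
  exact Finset.prod_ne_zero_iff.mpr fun v hv => linForm_ne_zero (hRp v hv)

theorem gaussFunctional_one {Rp : Finset (Space N)} {κ : Space N → ℝ}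
    (hκ : ∀ v ∈ Rp, 0 ≤ κ v) {ω : ℝ} (hω : 0 < ω) :
    gaussFunctional hκ hω 1 = gaussMass Rp κ ω := by
  simp [gaussFunctional_apply, gaussMass, regDensity_zero]

theorem gaussIntegrand_eq (Rp : Finset (Space N)) (κ : Space N → ℝ) (ω : ℝ) (p q : Poly N)
    (x : Space N) : gaussIntegrand Rp κ ω p q x =
      eval (fun i => x i) (p * q) * regDensity Rp κ ω 0 x := by
  rw [gaussIntegrand, regDensity_zero, map_mul]
  ring

/-- Positivity also encodes finiteness, because the Bochner integral of a nonintegrable function is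
0. -/
theorem gaussMass_pos {Rp : Finset (Space N)} {κ : Space N → ℝ}
    (hRp : ∀ v ∈ Rp, v ≠ 0) (hκ : ∀ v ∈ Rp, 0 ≤ κ v) {ω : ℝ} (hω : 0 < ω) :
    0 < gaussMass Rp κ ω := by
  refine lt_of_le_of_ne (integral_nonneg fun x => by positivity) fun h => ?_
  refine one_ne_zero (gaussFunctional_definite hRp hκ hω (1 : Poly N) ?_)
  rw [mul_one, gaussFunctional_one, h]

theorem isDunklGaussian_gaussFunctional {R : Finset (Space N)} (hR : IsReducedRootSystem R)
    {u₀ : Space N} (hu₀ : ∀ v ∈ R, inner ℝ u₀ v ≠ 0) {κ : Space N → ℝ}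
    (hκ : IsMultiplicity R κ) (hκ0 : ∀ v ∈ R, 0 ≤ κ v)
    (hκp : ∀ v ∈ posRoots R u₀, 0 ≤ κ v) {ω : ℝ} (hω : 0 < ω) :
    IsDunklGaussian (posRoots R u₀) κ ω (gaussFunctional hκp hω) where
  ne_zero v hv := hR.ne_zero v (mem_posRoots.mp hv).1
  definite := gaussFunctional_definite
    (fun v hv => hR.ne_zero v (mem_posRoots.mp hv).1) hκp hω
  reflPoly v hv p := by
    rw [gaussFunctional_apply, gaussFunctional_apply, ← integral_comp_refl v]
    simp only [eval_reflPoly, refl_refl,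
      regDensity_refl hR hu₀ hκ ω le_rfl (mem_posRoots.mp hv).1]
  parts i p q := by
    set Rp := posRoots R u₀ with hRp
    set L := gaussFunctional hκp hω with hL
    have h1 : ∀ f : Poly N, Filter.Tendsto
        (fun ε => ∫ x : Space N, eval (fun i => x i) f * regDensity Rp κ ω ε x)
        (nhdsWithin 0 (Set.Ioi 0)) (nhds (L f)) := fun f =>
      tendsto_integral_regDensity hκp hω f (fun _ _ => continuous_eval_space f)
        (fun _ _ _ => le_rfl) (Filter.Eventually.of_forall fun _ => tendsto_const_nhds)
    have h2 : ∀ v ∈ Rp, ∀ f : Poly N, Filter.Tendsto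
        (fun ε => ∫ x : Space N, eval (fun i => x i) f *
          (inner ℝ x v ^ 2 / (inner ℝ x v ^ 2 + ε)) * regDensity Rp κ ω ε x)
        (nhdsWithin 0 (Set.Ioi 0)) (nhds (L f)) := fun v hv f => by
      refine tendsto_integral_regDensity hκp hω f (fun ε hε => ?_) (fun ε hε x => ?_) ?_
      · refine (continuous_eval_space f).mul
          (Continuous.div (by fun_prop) (by fun_prop) fun x => ?_)
        positivity
      · rw [abs_mul]
        refine mul_le_of_le_one_right (abs_nonneg _) ?_
        rw [abs_of_nonneg (by positivity)]
        exact div_le_one_of_le₀ (le_add_of_nonneg_right hε.le) (by positivity)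
      -- The factor ⟨x,v⟩²/(⟨x,v⟩² + ε) lies in [0, 1] and tends to 1 off the mirror, a null set.
      · filter_upwards [ae_inner_ne_zero (hR.ne_zero v (mem_posRoots.mp hv).1)] with x hx
        have hc : ContinuousAt (fun ε : ℝ => eval (fun i => x i) f *
            (inner ℝ x v ^ 2 / (inner ℝ x v ^ 2 + ε))) 0 :=
          continuousAt_const.mul (continuousAt_const.div (by fun_prop) (by simpa using hx))
        have := hc.tendsto
        rw [add_zero, div_self (pow_ne_zero 2 hx), mul_one] at this
        exact tendsto_nhdsWithin_of_tendsto_nhds this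
    have hlim := (h1 (pderiv i (p * q))).add (tendsto_finsetSum Rp fun v hv =>
      (h2 v hv (divDiff v p * q + p * divDiff v q)).const_mul (κ v * v i))
    have heq := tendsto_nhds_unique (hlim.congr' ?_) ((h1 (X i * (p * q))).const_mul (2 * ω))
    · rw [← heq]
      simp only [dunklOp, LinearMap.add_apply, LinearMap.sum_apply, LinearMap.smul_apply,
        add_mul, mul_add, map_add, Finset.sum_mul, Finset.mul_sum, map_sum, smul_mul_assoc,
        mul_smul_comm, map_smul, Finset.sum_add_distrib, Derivation.leibniz, smul_eq_mul,
        Derivation.coeFn_coe, mul_comm q]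
      ring
    · filter_upwards [Ioc_mem_nhdsGT (zero_lt_one (α := ℝ))] with ε hε
      rw [← integral_pderiv_regDensity hκp hω hε]
      congr 1
      refine Finset.sum_congr rfl fun v hv => ?_
      rw [integral_kernel hR hu₀ hκ hκ0 hω hε (mem_posRoots.mp hv).1]

end Dunkl

end

theorem mainTheorem5 (N : ℕ) (R : Finset (Dunkl.Space N)) (hR : Dunkl.IsReducedRootSystem R)
    (u₀ : Dunkl.Space N) (hu₀ : ∀ v ∈ R, inner ℝ u₀ v ≠ 0)
    (κ : Dunkl.Space N → ℝ) (hκ : Dunkl.IsMultiplicity R κ) (hκ_nonneg : ∀ v ∈ R, 0 ≤ κ v)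
    (ω : ℝ) (hω : 0 < ω) (p q : Dunkl.Poly N) :
    0 < Dunkl.gaussMass (Dunkl.posRoots R u₀) κ ω ∧
    Integrable (Dunkl.gaussIntegrand (Dunkl.posRoots R u₀) κ ω p q) volume ∧
    Dunkl.algPairing (Dunkl.posRoots R u₀) κ ω
        (Dunkl.expLaplacian (Dunkl.posRoots R u₀) κ ω p)
        (Dunkl.expLaplacian (Dunkl.posRoots R u₀) κ ω q) =
      Dunkl.gaussPairing (Dunkl.posRoots R u₀) κ ω p q := by
  have hκp : ∀ v ∈ Dunkl.posRoots R u₀, 0 ≤ κ v := fun v hv =>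
    hκ_nonneg v (Dunkl.mem_posRoots.mp hv).1
  have hL := Dunkl.isDunklGaussian_gaussFunctional hR hu₀ hκ hκ_nonneg hκp hω
  have hpos := Dunkl.gaussMass_pos hL.ne_zero hκp hω
  refine ⟨hpos, ?_, ?_⟩
  · rw [funext (Dunkl.gaussIntegrand_eq (Dunkl.posRoots R u₀) κ ω p q)]
    exact Dunkl.integrable_eval_mul_regDensity hκp hω (by simp) _
  · have h := hL.algPairing_expLaplacian hω.ne' p q
    rw [Dunkl.gaussFunctional_one] at h
    rw [Dunkl.gaussPairing, funext (Dunkl.gaussIntegrand_eq (Dunkl.posRoots R u₀) κ ω p q),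
      ← Dunkl.gaussFunctional_apply hκp hω, ← h, inv_mul_cancel_left₀ hpos.ne']
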